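/- For $x\in\mathbb R$ let $L(x)=\liminf_{q\to\infty} q\,\operatorname{dist}(qx,\mathbb Z)$, where $q$ runs over the positive integers. A real number $x$ is called badly approximable if $L(x)>0$, and a badly approximable number $x$ is called decaying if there is a constant $C>0$ such that $L(ix)\le C/i$ for every positive integer $i$. Let $S$ be the set of badly approximable $x\in\mathbb R$ such that $$L\!\left(\tfrac ij x\right)\le \frac1{ij}\qquad\text{for all coprime positive integers } i,j .$$ Then $S$ has Hausdorff dimension $1$. Moreover, every element of $S$ is a decaying badly approximable number, and consequently the set of decaying badly approximable numbers also has Hausdorff dimension $1$. -/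

import Mathlib

open Filter Set

/-- The Lagrange constant `L(x) = liminf_{q → ∞} q · dist(q x, ℤ)` of a real number.
The sequence is nonnegative and, by Dirichlet's theorem, infinitely often at most `1`,
so this real-valued `liminf` is the usual one for every `x`. -/
noncomputable def lagrangeConst (x : ℝ) : ℝ :=
  liminf (fun q : ℕ => (q : ℝ) * Metric.infDist ((q : ℝ) * x) (range ((↑) : ℤ → ℝ))) atTop

/-- The set of badly approximable real numbers. -/
def badlyApproximable : Set ℝ := {x | 0 < lagrangeConst x}

/-- The set of decaying badly approximable real numbers. -/
def decayingBadlyApproximable : Set ℝ :=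
  {x | x ∈ badlyApproximable ∧
    ∃ C : ℝ, 0 < C ∧ ∀ i : ℕ, 0 < i → lagrangeConst ((i : ℝ) * x) ≤ C / (i : ℝ)}

/-- The badly approximable `x` with `L((i/j) x) ≤ 1/(ij)` for every positive rational `i/j`
written in lowest terms. -/
def fastDecaying : Set ℝ :=
  {x | x ∈ badlyApproximable ∧
    ∀ i j : ℕ, 0 < i → 0 < j → Nat.Coprime i j →
      lagrangeConst ((i : ℝ) / (j : ℝ) * x) ≤ 1 / ((i : ℝ) * (j : ℝ))}

/-!
The proof constructs, for every `s < 1`, a Cantor set of dimension at least `s` inside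
`fastDecaying`. Its points are generalized continued fractions: an integer matrix `X` of
determinant `±1` acts by `t ↦ (X₀₀ t + X₀₁) / (X₁₀ t + X₁₁)`, and a sequence `A` of such matrices
("digits"), all nonnegative, bounded, and mapping `[1, 3]` into itself, expands a number `t 0` with
tails `t n ∈ [1, 3]`. Let `M n = A 0 * ⋯ * A (n - 1)`.

* Bounded digits make `t 0` badly approximable, since the denominators of `M n` grow by a bounded
  factor at each stage (`IsExpansion.le_mul_abs`).
* As the tails are at least `1`, the fraction `p / q` in the first column of `M n` satisfies
  `|t 0 - p / q| ≤ 1 / q ^ 2`. If `i ∣ q` and `j ∣ p`, then `q / i` is a denominator witnessing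
  `1 / (i j)` for `(i / j) t 0` (`IsExpansion.frequently_le`). It suffices that for each coprime
  pair `(i, j)` these divisibilities hold for infinitely many `n`.
* The matrices of the partial quotients `1` and `2` generate, as a monoid, a subgroup containing
  `SL(2, ℤ / m)`; as `GL(2, ℤ / m)` is finite, there is a single word in them that meets the
  divisibility condition whatever the preceding product is (`exists_universal_word`).
* All words in `1, 2` are inserted infinitely often at fixed positions of density zero
  (`exists_sparse_schedule`); the remaining positions are free.
* The free digits are attached to the fractions `(q + r) / q` with `K < q ≤ 4 K`, `r < q` coprime to
  `q`. There are at least `K ^ 2` of them (`sq_le_sum_totient`), their images of `[1, 3]` are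
  `1 / (32 K ^ 2)` apart (`digit_separation`), and they contract by at most a constant times
  `K ^ (-2)`. Reading the free digits as a base-`D` expansion is then a Hölder map onto `[0, 1]`
  with exponent tending to `1` as `K → ∞` (`le_dimH_range_of_digit_separation`).
-/

/-! ### Hausdorff dimension of sets coded by digit sequences -/

/-- If sequences that first differ at index `k` have `x`-images at distance at least a constant
times `D ^ (-k / s)`, then reading the coding sequence in base `D` is an `s`-Hölder map from the
range of `x` onto `[0, 1]`, so the range has dimension at least `s`. -/
theorem le_dimH_range_of_digit_separation {D : ℕ} (hD : 1 < D) (x : (ℕ → Fin D) → ℝ)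
    {s C : NNReal} (hs : 0 < s)
    (h : ∀ (f g : ℕ → Fin D) (k : ℕ), (∀ l < k, f l = g l) → f k ≠ g k →
      ((D : ℝ) ^ k)⁻¹ ≤ C * |x f - x g| ^ (s : ℝ)) :
    (s : ENNReal) ≤ dimH (range x) := by
  have key : ∀ f g, |Real.ofDigits f - Real.ofDigits g| ≤ C * |x f - x g| ^ (s : ℝ) := by
    intro f g
    by_cases hfg : f = g
    · subst hfg; simp; positivity
    · have hex : ∃ k, f k ≠ g k := Function.ne_iff.mp hfg
      classical
      have h1 : ∀ l < Nat.find hex, f l = g l := fun l hl => not_not.mp (Nat.find_min hex hl)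
      exact (Real.abs_ofDigits_sub_ofDigits_le h1).trans (h f g _ h1 (Nat.find_spec hex))
  have hinj : ∀ f g, x f = x g → Real.ofDigits f = Real.ofDigits g := by
    intro f g hfg
    have := key f g
    rw [hfg, sub_self, abs_zero, Real.zero_rpow (by positivity), mul_zero] at this
    exact sub_eq_zero.mp (abs_nonpos_iff.mp this)
  have : NeZero D := ⟨by omega⟩
  let y : ℝ → ℝ := fun r => Real.ofDigits (Function.invFun x r)
  have hy : ∀ f, y (x f) = Real.ofDigits f := fun f =>
    hinj _ _ (Function.invFun_eq (f := x) ⟨f, rfl⟩)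
  have hol : HolderOnWith C s y (range x) := by
    rintro _ ⟨f, rfl⟩ _ ⟨g, rfl⟩
    rw [hy, hy, edist_dist, edist_dist, Real.dist_eq, Real.dist_eq,
      ENNReal.ofReal_rpow_of_nonneg (abs_nonneg _) s.coe_nonneg,
      ← ENNReal.ofReal_coe_nnreal (p := C), ← ENNReal.ofReal_mul C.coe_nonneg]
    exact ENNReal.ofReal_le_ofReal (key f g)
  have him : Icc (0 : ℝ) 1 ⊆ y '' range x := by
    intro r hr
    obtain ⟨f, -, hf⟩ := Real.ofDigits_SurjOn hD hr
    exact ⟨x f, ⟨f, rfl⟩, (hy f).trans hf⟩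
  have h1 : (1 : ENNReal) ≤ dimH (range x) / s := by
    refine le_trans ?_ (hol.dimH_image_le hs)
    refine le_trans ?_ (dimH_mono him)
    rw [Real.dimH_of_nonempty_interior
      (by rw [interior_Icc]; exact ⟨1 / 2, by norm_num, by norm_num⟩)]
    simp
  rwa [ENNReal.le_div_iff_mul_le (by left; exact_mod_cast hs.ne') (by left; simp), one_mul] at h1

/-! ### Bounds for the Lagrange constant -/

theorem lagrangeConst_le_of_frequently {y b : ℝ}
    (h : ∃ᶠ q : ℕ in atTop, ∃ u : ℤ, (q : ℝ) * |(q : ℝ) * y - u| ≤ b) :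
    lagrangeConst y ≤ b := by
  refine liminf_le_of_frequently_le (h.mono ?_) ⟨0, ?_⟩
  · rintro q ⟨u, hu⟩
    refine le_trans (mul_le_mul_of_nonneg_left ?_ (Nat.cast_nonneg q)) hu
    exact Metric.infDist_le_dist_of_mem ⟨u, rfl⟩
  · exact eventually_map.mpr (Eventually.of_forall fun q =>
      mul_nonneg (Nat.cast_nonneg q) Metric.infDist_nonneg)

/-- The hypothesis `h` guarantees that the real-valued `liminf` is not a junk value: the sequence
does not tend to infinity. -/
theorem le_lagrangeConst {y b c : ℝ}
    (h : ∃ᶠ q : ℕ in atTop, ∃ u : ℤ, (q : ℝ) * |(q : ℝ) * y - u| ≤ b)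
    (hc : ∀ q : ℕ, 0 < q → ∀ u : ℤ, c ≤ (q : ℝ) * |(q : ℝ) * y - u|) :
    c ≤ lagrangeConst y := by
  refine le_liminf_of_le ?_ ?_
  · refine IsCoboundedUnder.of_frequently_le (a := b) (h.mono ?_)
    rintro q ⟨u, hu⟩
    refine le_trans (mul_le_mul_of_nonneg_left ?_ (Nat.cast_nonneg q)) hu
    exact Metric.infDist_le_dist_of_mem ⟨u, rfl⟩
  · filter_upwards [eventually_gt_atTop 0] with q hq
    have hq' : (0 : ℝ) < q := Nat.cast_pos.mpr hq
    rw [← div_le_iff₀' hq', Metric.le_infDist (range_nonempty _)]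
    rintro _ ⟨u, rfl⟩
    rw [div_le_iff₀' hq']
    exact hc q hq u

/-! ### Expansions of real numbers in matrix digits -/

/-- An integer matrix of determinant `±1` with entries in `[0, H]` whose Möbius action
`t ↦ (X₀₀ t + X₀₁) / (X₁₀ t + X₁₁)` maps `[1, 3]` into itself. The last four inequalities, rather
than the mapping property itself, are recorded since they are linear in the entries; only the
lower right entry may vanish. -/
structure IsDigit (H : ℤ) (X : Matrix (Fin 2) (Fin 2) ℤ) : Prop where
  det_sq : X.det ^ 2 = 1
  one_le_00 : 1 ≤ X 0 0
  one_le_01 : 1 ≤ X 0 1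
  one_le_10 : 1 ≤ X 1 0
  nonneg_11 : 0 ≤ X 1 1
  le_00 : X 0 0 ≤ H
  le_01 : X 0 1 ≤ H
  col0_le : X 1 0 ≤ X 0 0
  col1_le : X 1 1 ≤ X 0 1
  col0_le3 : X 0 0 ≤ 3 * X 1 0
  sum_le3 : X 0 0 + X 0 1 ≤ 3 * (X 1 0 + X 1 1)

/-- The numbers `t n ∈ [1, 3]` are the tails of an expansion of `t 0` with digits `A`: each `t n` is
the image of `t (n + 1)` under the Möbius action of `A n`, written without division. -/
structure IsExpansion (A : ℕ → Matrix (Fin 2) (Fin 2) ℤ) (t : ℕ → ℝ) : Prop where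
  one_le : ∀ n, 1 ≤ t n
  le_three : ∀ n, t n ≤ 3
  step : ∀ n, t n * (A n 1 0 * t (n + 1) + A n 1 1) = A n 0 0 * t (n + 1) + A n 0 1

theorem IsDigit.exists_preimage {H : ℤ} {X : Matrix (Fin 2) (Fin 2) ℤ} (hX : IsDigit H X) {t : ℝ}
    (h1 : 1 ≤ t) :
    ∃ s : ℝ, 1 ≤ s ∧ s ≤ 3 ∧ s * (X 1 0 * t + X 1 1) = X 0 0 * t + X 0 1 := by
  have a1 : (1 : ℝ) ≤ X 1 0 := mod_cast hX.one_le_10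
  have a2 : (0 : ℝ) ≤ X 1 1 := mod_cast hX.nonneg_11
  have a3 : (X 1 0 : ℝ) ≤ X 0 0 := mod_cast hX.col0_le
  have a4 : (X 1 1 : ℝ) ≤ X 0 1 := mod_cast hX.col1_le
  have a5 : (X 0 0 : ℝ) ≤ 3 * X 1 0 := mod_cast hX.col0_le3
  have a6 : (X 0 0 : ℝ) + X 0 1 ≤ 3 * (X 1 0 + X 1 1) := mod_cast hX.sum_le3
  have hpos : 0 < (X 1 0 : ℝ) * t + X 1 1 := by nlinarith
  refine ⟨(X 0 0 * t + X 0 1) / (X 1 0 * t + X 1 1), ?_, ?_, div_mul_cancel₀ _ hpos.ne'⟩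
  · rw [one_le_div hpos]; nlinarith
  · rw [div_le_iff₀ hpos]; nlinarith

/-- Every digit sequence expands some number: the finite systems of equations are solved backwards
from `t n = 1`, and compactness of `[1, 3]^ℕ` gives a solution of all of them. -/
theorem exists_isExpansion {H : ℤ} {A : ℕ → Matrix (Fin 2) (Fin 2) ℤ} (hA : ∀ n, IsDigit H (A n)) :
    ∃ t, IsExpansion A t := by
  let K : ℕ → Set (ℕ → ℝ) := fun n =>
    {t | (∀ k, t k ∈ Icc (1 : ℝ) 3) ∧
      ∀ k < n, t k * (A k 1 0 * t (k + 1) + A k 1 1) = A k 0 0 * t (k + 1) + A k 0 1}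
  have hne : ∀ n (A : ℕ → Matrix (Fin 2) (Fin 2) ℤ), (∀ k, IsDigit H (A k)) →
      ∃ t : ℕ → ℝ, (∀ k, t k ∈ Icc (1 : ℝ) 3) ∧
      ∀ k < n, t k * (A k 1 0 * t (k + 1) + A k 1 1) = A k 0 0 * t (k + 1) + A k 0 1 := by
    intro n
    induction n with
    | zero => intro A _; exact ⟨fun _ => 1, fun _ => ⟨le_rfl, by norm_num⟩, by simp⟩
    | succ n ih =>
      intro A hA
      obtain ⟨t, ht, hs⟩ := ih (fun k => A (k + 1)) (fun k => hA (k + 1))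
      obtain ⟨r, h1, h3, hr⟩ := (hA 0).exists_preimage (ht 0).1
      refine ⟨fun k => Nat.casesOn k r t, ?_, ?_⟩
      · rintro (_ | k)
        · exact ⟨h1, h3⟩
        · exact ht k
      · rintro (_ | k) hk
        · exact hr
        · exact hs k (by omega)
  have hclosed : ∀ n, IsClosed (K n) := by
    intro n
    have h : K n = (⋂ k, {t | t k ∈ Icc (1 : ℝ) 3}) ∩ ⋂ k, ⋂ _ : k < n, {t : ℕ → ℝ |
        t k * (A k 1 0 * t (k + 1) + A k 1 1) = A k 0 0 * t (k + 1) + A k 0 1} := by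
      ext t
      simp [K]
    rw [h]
    refine IsClosed.inter (isClosed_iInter fun k => isClosed_Icc.preimage (continuous_apply k))
      (isClosed_iInter fun k => isClosed_iInter fun _ => isClosed_eq ?_ ?_) <;> fun_prop
  obtain ⟨t, ht⟩ := IsCompact.nonempty_iInter_of_sequence_nonempty_isCompact_isClosed K
    (fun n t ht => ⟨ht.1, fun k hk => ht.2 k (by omega)⟩) (fun n => hne n A hA)
    ((isCompact_univ_pi (fun _ : ℕ => isCompact_Icc (a := (1 : ℝ)) (b := 3))).of_isClosed_subset
      (hclosed 0) (fun t ht k _ => ht.1 k)) hclosed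
  rw [mem_iInter] at ht
  exact ⟨t, fun n => ((ht 0).1 n).1, fun n => ((ht 0).1 n).2,
    fun n => (ht (n + 1)).2 n (Nat.lt_succ_self n)⟩

/-- The product `A 0 * ⋯ * A (n - 1)`; its columns are the analogues of successive convergents. -/
def prefixProd (A : ℕ → Matrix (Fin 2) (Fin 2) ℤ) : ℕ → Matrix (Fin 2) (Fin 2) ℤ
  | 0 => 1
  | n + 1 => prefixProd A n * A n

theorem prefixProd_succ_apply (A : ℕ → Matrix (Fin 2) (Fin 2) ℤ) (n : ℕ) (i j : Fin 2) :
    prefixProd A (n + 1) i j = prefixProd A n i 0 * A n 0 j + prefixProd A n i 1 * A n 1 j := by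
  rw [prefixProd, Matrix.mul_apply, Fin.sum_univ_two]

section
variable {H : ℤ} {A : ℕ → Matrix (Fin 2) (Fin 2) ℤ}

theorem prefixProd_det_sq (hA : ∀ n, IsDigit H (A n)) (n : ℕ) : (prefixProd A n).det ^ 2 = 1 := by
  induction n with
  | zero => simp [prefixProd]
  | succ n ih => rw [prefixProd, Matrix.det_mul, mul_pow, ih, (hA n).det_sq, one_mul]

theorem prefixProd_nonneg (hA : ∀ n, IsDigit H (A n)) (n : ℕ) (i j : Fin 2) :
    0 ≤ prefixProd A n i j := by
  induction n generalizing j with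
  | zero => fin_cases i <;> fin_cases j <;> simp [prefixProd]
  | succ n ih =>
    have h : ∀ k, 0 ≤ A n k j := by
      have := hA n
      intro k
      fin_cases k <;> fin_cases j <;> simp <;>
        linarith [this.one_le_00, this.one_le_01, this.one_le_10, this.nonneg_11]
    rw [prefixProd_succ_apply]
    exact add_nonneg (mul_nonneg (ih 0) (h 0)) (mul_nonneg (ih 1) (h 1))

theorem prefixProd_add_le_succ (hA : ∀ n, IsDigit H (A n)) (n : ℕ) :
    prefixProd A n 1 0 + prefixProd A n 1 1 ≤ prefixProd A (n + 1) 1 0 := by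
  rw [prefixProd_succ_apply]
  nlinarith [(hA n).one_le_00, (hA n).one_le_10, prefixProd_nonneg hA n 1 0,
    prefixProd_nonneg hA n 1 1]

/-- The denominators tend to infinity. The first step can leave the sum of the bottom row equal to
`1`, but from then on it grows strictly. -/
theorem le_prefixProd_add (hA : ∀ n, IsDigit H (A n)) (n : ℕ) :
    (n : ℤ) ≤ prefixProd A n 1 0 + prefixProd A n 1 1 ∧
      1 ≤ prefixProd A n 1 0 + prefixProd A n 1 1 := by
  have h0 : ∀ n, 1 ≤ prefixProd A n 1 0 + prefixProd A n 1 1 := by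
    intro n
    induction n with
    | zero => simp [prefixProd]
    | succ n ih => linarith [prefixProd_add_le_succ hA n, prefixProd_nonneg hA (n + 1) 1 1]
  refine ⟨?_, h0 n⟩
  induction n with
  | zero => simp [prefixProd]
  | succ n ih =>
    rcases Nat.eq_zero_or_pos n with rfl | hn
    · simpa using h0 1
    have hc : 1 ≤ prefixProd A n 1 0 := by
      obtain ⟨m, rfl⟩ := Nat.exists_eq_succ_of_ne_zero hn.ne'
      linarith [prefixProd_add_le_succ hA m, h0 m]
    have h1 := prefixProd_add_le_succ hA n
    have h2 : prefixProd A n 1 0 ≤ prefixProd A (n + 1) 1 1 := by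
      rw [prefixProd_succ_apply]
      nlinarith [(hA n).one_le_01, (hA n).nonneg_11, prefixProd_nonneg hA n 1 1]
    push_cast
    linarith

theorem prefixProd_add_succ_le (hA : ∀ n, IsDigit H (A n)) (n : ℕ) :
    prefixProd A (n + 1) 1 0 + prefixProd A (n + 1) 1 1 ≤
      2 * H * (prefixProd A n 1 0 + prefixProd A n 1 1) := by
  rw [prefixProd_succ_apply, prefixProd_succ_apply]
  have := hA n
  nlinarith [mul_nonneg (prefixProd_nonneg hA n 1 0) (sub_nonneg.mpr this.le_00),
    mul_nonneg (prefixProd_nonneg hA n 1 0) (sub_nonneg.mpr this.le_01),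
    mul_nonneg (prefixProd_nonneg hA n 1 1) (sub_nonneg.mpr (this.col0_le.trans this.le_00)),
    mul_nonneg (prefixProd_nonneg hA n 1 1) (sub_nonneg.mpr (this.col1_le.trans this.le_01))]

theorem IsExpansion.mobius_eq {t : ℕ → ℝ} (hA : ∀ n, IsDigit H (A n)) (ht : IsExpansion A t)
    (n : ℕ) :
    t 0 * (prefixProd A n 1 0 * t n + prefixProd A n 1 1) =
      prefixProd A n 0 0 * t n + prefixProd A n 0 1 := by
  induction n with
  | zero => simp [prefixProd]
  | succ n ih =>
    have hs := ht.step n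
    have a1 : (1 : ℝ) ≤ A n 1 0 := mod_cast (hA n).one_le_10
    have a2 : (0 : ℝ) ≤ A n 1 1 := mod_cast (hA n).nonneg_11
    have h1 := ht.one_le (n + 1)
    simp only [prefixProd_succ_apply]
    push_cast
    have hpos : 0 < (A n 1 0 : ℝ) * t (n + 1) + A n 1 1 := by nlinarith
    linear_combination (A n 1 0 * t (n + 1) + A n 1 1 : ℝ) * ih +
      (prefixProd A n 0 0 - t 0 * prefixProd A n 1 0) * hs

/-- A number with bounded digits is badly approximable, with an explicit constant. -/
theorem IsExpansion.le_mul_abs {t : ℕ → ℝ} (hA : ∀ n, IsDigit H (A n)) (ht : IsExpansion A t)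
    (q : ℕ) (hq : 0 < q) (u : ℤ) :
    1 / (6 * (H : ℝ)) ≤ (q : ℝ) * |(q : ℝ) * t 0 - u| := by
  classical
  -- `n + 1` is the first stage at which the bottom row sum exceeds `q`.
  have hex : ∃ n, (q : ℤ) < prefixProd A n 1 0 + prefixProd A n 1 1 :=
    ⟨q + 1, by have := (le_prefixProd_add hA (q + 1)).1; push_cast at this; linarith⟩
  obtain ⟨n, hn⟩ : ∃ n, Nat.find hex = n + 1 := by
    refine Nat.exists_eq_succ_of_ne_zero fun h => ?_
    have := Nat.find_spec hex
    rw [h] at this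
    simp [prefixProd] at this
    omega
  have hlt := Nat.find_spec hex
  have hle := Nat.find_min hex (m := n) (by omega)
  rw [hn] at hlt
  have hup := prefixProd_add_succ_le hA n
  have hx := ht.mobius_eq hA (n + 1)
  have hd := prefixProd_det_sq hA (n + 1)
  have hc := prefixProd_nonneg hA (n + 1) 1 0
  have hdd := prefixProd_nonneg hA (n + 1) 1 1
  have h1 := ht.one_le (n + 1)
  have h3 := ht.le_three (n + 1)
  have hH : 1 ≤ H := (hA 0).one_le_00.trans (hA 0).le_00
  rw [Matrix.det_fin_two] at hd
  set T := t (n + 1)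
  generalize hM : prefixProd A (n + 1) = M at *
  set a := M 0 0
  set b := M 0 1
  set c := M 1 0
  set d := M 1 1
  -- the coordinates of `(u, q)` in the basis of columns, up to the common sign `det M`
  set r : ℤ := d * u - b * q with hr
  set s : ℤ := a * q - c * u with hs
  have hcs : (a * d - b * c) * q = c * r + d * s := by rw [hr, hs]; ring
  -- The entries of the bottom row are nonnegative with sum larger than `q > 0`, so the
  -- coordinates cannot both be nonzero with the same sign.
  have hsign : (1 : ℝ) ≤ |T * s - r| := by
    have hcase : (s = 0 ∧ r = 0) ∨ (0 < r ∧ 0 < s) ∨ (r < 0 ∧ s < 0) ∨ (0 < s ∧ r ≤ 0) ∨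
      (s < 0 ∧ 0 ≤ r) ∨ (s = 0 ∧ r ≠ 0) := by omega
    have hq' : (0 : ℤ) < q := mod_cast hq
    have hdet : a * d - b * c = 1 ∨ a * d - b * c = -1 := sq_eq_one_iff.mp hd
    rcases hcase with ⟨h, h'⟩ | ⟨h, h'⟩ | ⟨h, h'⟩ | ⟨h, h'⟩ | ⟨h, h'⟩ | ⟨h, h'⟩
    · rcases hdet with e | e <;> rw [e, h, h'] at hcs <;> omega
    · rcases hdet with e | e <;> rw [e] at hcs <;> nlinarith
    · rcases hdet with e | e <;> rw [e] at hcs <;> nlinarith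
    · have e1 : (1 : ℝ) ≤ s := mod_cast h
      have e2 : (r : ℝ) ≤ 0 := mod_cast h'
      exact le_abs.mpr (Or.inl (by nlinarith))
    · have e1 : (s : ℝ) ≤ -1 := mod_cast Int.le_sub_one_of_lt h
      have e2 : (0 : ℝ) ≤ r := mod_cast h'
      exact le_abs.mpr (Or.inr (by nlinarith))
    · rw [h, Int.cast_zero, mul_zero, zero_sub, abs_neg]
      exact_mod_cast Int.one_le_abs h'
  have hid : ((q : ℝ) * t 0 - u) * (c * T + d) = T * s - r := by
    rw [hr, hs]; push_cast; linear_combination (q : ℝ) * hx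
  have hc' : (0 : ℝ) ≤ c := mod_cast hc
  have hd' : (0 : ℝ) ≤ d := mod_cast hdd
  have hH' : (1 : ℝ) ≤ H := mod_cast hH
  have hbound : (c : ℝ) * T + d ≤ 6 * H * q := by
    have e1 : (c : ℝ) + d ≤ 2 * H * q := by
      have : c + d ≤ 2 * H * q := hup.trans (by nlinarith)
      exact_mod_cast this
    nlinarith
  rw [div_le_iff₀ (by positivity)]
  rw [← hid, abs_mul, abs_of_nonneg (by positivity : (0 : ℝ) ≤ c * T + d)] at hsign
  nlinarith [abs_nonneg ((q : ℝ) * t 0 - u)]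

/-- Convergents whose denominator is divisible by `i` and whose numerator is divisible by `j` give
good approximations of `(i / j) * t 0`. -/
theorem IsExpansion.frequently_le {t : ℕ → ℝ} (hA : ∀ n, IsDigit H (A n)) (ht : IsExpansion A t)
    {i j : ℕ} (hi : 0 < i) (hj : 0 < j)
    (h : ∀ n₀, ∃ n ≥ n₀, (i : ℤ) ∣ prefixProd A n 1 0 ∧ (j : ℤ) ∣ prefixProd A n 0 0) :
    ∃ᶠ q : ℕ in atTop, ∃ u : ℤ,
      (q : ℝ) * |(q : ℝ) * ((i : ℝ) / (j : ℝ) * t 0) - u| ≤ 1 / ((i : ℝ) * (j : ℝ)) := by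
  rw [frequently_atTop]
  intro N
  obtain ⟨n, hn, ⟨q, hq⟩, ⟨u, hu⟩⟩ := h (i * N + 1 + 1)
  obtain ⟨m, rfl⟩ : ∃ m, n = m + 1 := ⟨n - 1, by omega⟩
  have hbig : (i * N + 1 : ℤ) ≤ i * q := by
    rw [← hq]
    have h1 := (le_prefixProd_add hA m).1
    have h2 := prefixProd_add_le_succ hA m
    have h3 : ((i * N + 1 : ℕ) : ℤ) ≤ m := by exact_mod_cast (by omega : i * N + 1 ≤ m)
    push_cast at h3
    linarith
  have hi' : (0 : ℤ) < i := mod_cast hi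
  have hqN : (N : ℤ) ≤ q := by
    refine le_of_mul_le_mul_left (a := (i : ℤ)) ?_ hi'
    linarith
  lift q to ℕ using (Int.natCast_nonneg N).trans hqN
  refine ⟨q, by exact_mod_cast hqN, u, ?_⟩
  have hx := ht.mobius_eq hA (m + 1)
  have hd := prefixProd_det_sq hA (m + 1)
  have hdd := prefixProd_nonneg hA (m + 1) 1 1
  have h1 := ht.one_le (m + 1)
  rw [Matrix.det_fin_two] at hd
  rw [hu, hq] at hx hd
  set T := t (m + 1)
  set b := prefixProd A (m + 1) 0 1
  set d := prefixProd A (m + 1) 1 1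
  have iR : (0 : ℝ) < i := mod_cast hi
  have jR : (0 : ℝ) < j := mod_cast hj
  have hqpos : (0 : ℝ) < i * q := by
    have h0 : (0 : ℤ) < i * q := lt_of_lt_of_le (by positivity) hbig
    exact_mod_cast h0
  have hd' : (0 : ℝ) ≤ d := mod_cast hdd
  have hden : (i * q : ℝ) ≤ i * q * T + d := by nlinarith
  have hkey : ((i : ℝ) * q * t 0 - j * u) * (i * q * T + d) = -(j * u * d - b * (i * q)) := by
    push_cast at hx
    linear_combination (i * q : ℝ) * hx
  have habs : |(i : ℝ) * q * t 0 - j * u| * (i * q * T + d) = 1 := by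
    rw [← abs_of_nonneg (hqpos.le.trans hden), ← abs_mul, hkey, abs_neg]
    have h2 : ((j : ℝ) * u * d - b * (i * q)) ^ 2 = 1 := by exact_mod_cast hd
    rcases sq_eq_one_iff.mp h2 with e | e <;> rw [e] <;> norm_num
  have hle : |(i : ℝ) * q * t 0 - j * u| * (i * q) ≤ 1 :=
    (mul_le_mul_of_nonneg_left hden (abs_nonneg _)).trans habs.le
  have hrw : (q : ℝ) * (i / j * t 0) - u = (i * q * t 0 - j * u) / j := by
    field_simp
  rw [hrw, abs_div, abs_of_pos jR, le_div_iff₀ (by positivity)]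
  calc (q : ℝ) * (|(i : ℝ) * q * t 0 - j * u| / j) * (i * j)
      = |(i : ℝ) * q * t 0 - j * u| * (i * q) := by field_simp
    _ ≤ 1 := hle

end

/-! ### Products of the matrices of the partial quotients one and two -/

section

open Matrix MatrixGroups

/-- The digit `t ↦ k + 1 / t`, where the partial quotient `k` is `1` for `false` and `2` for
`true`. -/
def wordDigit (b : Bool) : Matrix (Fin 2) (Fin 2) ℤ := !![if b then 2 else 1, 1; 1, 0]

theorem isDigit_wordDigit (b : Bool) : IsDigit 2 (wordDigit b) := by
  cases b <;> constructor <;> simp [wordDigit, Matrix.det_fin_two]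

/-- The product of the digits of a word in the partial quotients `1` and `2`. -/
def wordProd (w : List Bool) : Matrix (Fin 2) (Fin 2) ℤ := (w.map wordDigit).prod

theorem wordProd_append (v w : List Bool) : wordProd (v ++ w) = wordProd v * wordProd w := by
  simp [wordProd]

theorem wordProd_det_sq (w : List Bool) : (wordProd w).det ^ 2 = 1 := by
  induction w with
  | nil => simp [wordProd]
  | cons b w ih =>
    have h : wordProd (b :: w) = wordDigit b * wordProd w := by simp [wordProd]
    rw [h, Matrix.det_mul, mul_pow, ih, (isDigit_wordDigit b).det_sq, one_mul]

/-- The matrix `wordDigit b` as an element of `GL(2, ℤ)`. -/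
def wordUnit (b : Bool) : GL (Fin 2) ℤ where
  val := wordDigit b
  inv := !![0, 1; 1, -(if b then 2 else 1)]
  val_inv := by cases b <;> simp [wordDigit, Matrix.one_fin_two]
  inv_val := by cases b <;> simp [wordDigit, Matrix.one_fin_two]

theorem toGL_mem_closure_wordUnit (X : SL(2, ℤ)) :
    SpecialLinearGroup.toGL X ∈ Subgroup.closure (range wordUnit) := by
  have hA : wordUnit false ∈ Subgroup.closure (range wordUnit) :=
    Subgroup.subset_closure ⟨_, rfl⟩
  have hB : wordUnit true ∈ Subgroup.closure (range wordUnit) :=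
    Subgroup.subset_closure ⟨_, rfl⟩
  have coe_T : ((SpecialLinearGroup.toGL ModularGroup.T : GL (Fin 2) ℤ) :
      Matrix (Fin 2) (Fin 2) ℤ) = !![1, 1; 0, 1] := rfl
  have coe_S : ((SpecialLinearGroup.toGL ModularGroup.S : GL (Fin 2) ℤ) :
      Matrix (Fin 2) (Fin 2) ℤ) = !![0, -1; 1, 0] := rfl
  have hT : SpecialLinearGroup.toGL ModularGroup.T = wordUnit true * (wordUnit false)⁻¹ := by
    rw [eq_mul_inv_iff_mul_eq]
    ext i j
    fin_cases i <;> fin_cases j <;>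
      simp [wordUnit, wordDigit, coe_T, Matrix.mul_apply, Fin.sum_univ_two]
  have hS : SpecialLinearGroup.toGL ModularGroup.S =
      (SpecialLinearGroup.toGL ModularGroup.T)⁻¹ * (SpecialLinearGroup.toGL ModularGroup.T)⁻¹ *
        wordUnit false * wordUnit false * (SpecialLinearGroup.toGL ModularGroup.T)⁻¹ := by
    rw [eq_mul_inv_iff_mul_eq, mul_assoc, mul_assoc, eq_inv_mul_iff_mul_eq, eq_inv_mul_iff_mul_eq]
    ext i j
    fin_cases i <;> fin_cases j <;>
      simp [wordUnit, wordDigit, coe_T, coe_S, Matrix.mul_apply, Fin.sum_univ_two]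
  have hTm : SpecialLinearGroup.toGL ModularGroup.T ∈ Subgroup.closure (range wordUnit) :=
    hT ▸ mul_mem hB (inv_mem hA)
  have hX : X ∈ Subgroup.closure {ModularGroup.S, ModularGroup.T} := by
    rw [SpecialLinearGroup.SL2Z_generators]; trivial
  have hle : Subgroup.closure {ModularGroup.S, ModularGroup.T} ≤
      (Subgroup.closure (range wordUnit)).comap SpecialLinearGroup.toGL := by
    rw [Subgroup.closure_le]
    rintro _ (rfl | rfl)
    · rw [SetLike.mem_coe, Subgroup.mem_comap, hS]
      exact mul_mem (mul_mem (mul_mem (mul_mem (inv_mem hTm) (inv_mem hTm)) hA) hA) (inv_mem hTm)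
    · exact hTm
  exact hle hX

/-- In the finite group `GL(2, ℤ / m)` the monoid generated by a set is a group, so inverses cost
nothing and every element of `SL(2, ℤ)` is congruent to a word. -/
theorem exists_wordProd_eq_mod (m : ℕ) [NeZero m] (X : SL(2, ℤ)) :
    ∃ w : List Bool, (wordProd w).map (Int.cast : ℤ → ZMod m) =
      (X : Matrix (Fin 2) (Fin 2) ℤ).map Int.cast := by
  let φ : GL (Fin 2) ℤ →* GL (Fin 2) (ZMod m) :=
    Matrix.GeneralLinearGroup.map (Int.castRingHom (ZMod m))
  have h1 : φ (SpecialLinearGroup.toGL X) ∈ Subgroup.closure (range (φ ∘ wordUnit)) := by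
    rw [range_comp, ← MonoidHom.map_closure]
    exact Subgroup.mem_map_of_mem φ (toGL_mem_closure_wordUnit X)
  rw [← Subgroup.mem_toSubmonoid, Subgroup.closure_toSubmonoid_of_finite] at h1
  have h2 : ∀ g ∈ Submonoid.closure (range (φ ∘ wordUnit)),
      ∃ w : List Bool, (Int.castRingHom (ZMod m)).mapMatrix (wordProd w) = g.1 := by
    intro g hg
    induction hg using Submonoid.closure_induction with
    | mem g hg =>
      obtain ⟨b, rfl⟩ := hg
      exact ⟨[b], by simp [wordProd]; rfl⟩
    | one => exact ⟨[], by simp [wordProd]⟩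
    | mul g h _ _ ig ih =>
      obtain ⟨v, hv⟩ := ig
      obtain ⟨w, hw⟩ := ih
      exact ⟨v ++ w, by rw [wordProd_append, map_mul, hv, hw]; rfl⟩
  exact h2 _ h1

/-- The first column `(p, q)` of `M` satisfies `i ∣ q` and `j ∣ p`. -/
def ColumnDvd (i j : ℕ) (M : Matrix (Fin 2) (Fin 2) ℤ) : Prop :=
  (i : ℤ) ∣ M 1 0 ∧ (j : ℤ) ∣ M 0 0

theorem ColumnDvd.congr {i j : ℕ} {M M' : Matrix (Fin 2) (Fin 2) ℤ} (h : ColumnDvd i j M)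
    (hM : M.map (Int.cast : ℤ → ZMod (i * j)) = M'.map Int.cast) : ColumnDvd i j M' := by
  have e : ∀ a b, ((i * j : ℕ) : ℤ) ∣ M' a b - M a b := fun a b =>
    (ZMod.intCast_eq_intCast_iff_dvd_sub _ _ _).mp (congrFun (congrFun hM a) b)
  refine ⟨?_, ?_⟩
  · have := (Dvd.intro (j : ℤ) (by push_cast; rfl)).trans (e 1 0)
    simpa using dvd_add this h.1
  · have := (Dvd.intro_left (i : ℤ) (by push_cast; rfl)).trans (e 0 0)
    simpa using dvd_add this h.2

theorem map_intCast_mul (m : ℕ) (M N : Matrix (Fin 2) (Fin 2) ℤ) :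
    (M * N).map (Int.cast : ℤ → ZMod m) = M.map Int.cast * N.map Int.cast :=
  map_mul (Int.castRingHom (ZMod m)).mapMatrix M N

/-- Modulo `i * j`, a word can be found that carries the first column of `M` to `(j, i)`. -/
theorem exists_word_columnDvd {i j : ℕ} (hi : 0 < i) (hj : 0 < j) (hij : Nat.Coprime i j)
    (M : Matrix (Fin 2) (Fin 2) ℤ) (hM : M.det ^ 2 = 1) :
    ∃ w, ColumnDvd i j (M * wordProd w) := by
  have : NeZero (i * j) := ⟨(Nat.mul_pos hi hj).ne'⟩
  obtain ⟨⟨W, hW⟩, hW0, hW1⟩ := (Nat.isCoprime_iff_coprime.mpr hij).symm.exists_SL2_col 0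
  change W 0 0 = _ at hW0
  change W 1 0 = _ at hW1
  -- `Y` is `M⁻¹ * W * diag(1, det M)`; the last factor corrects the determinant to `1` and leaves
  -- the first column of `M * Y` equal to that of `W`.
  let Y : Matrix (Fin 2) (Fin 2) ℤ :=
    (M.det • M.adjugate) * (W * !![1, 0; 0, M.det])
  have hdetY : Y.det = 1 := by
    have : (!![1, 0; 0, M.det] : Matrix (Fin 2) (Fin 2) ℤ).det = M.det := by
      simp [Matrix.det_fin_two]
    rw [Matrix.det_mul, Matrix.det_mul, this, Matrix.det_smul, Matrix.det_adjugate,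
      hW]
    simp
    linear_combination (M.det ^ 2 + 1) * hM
  have hMY : M * Y = W * !![1, 0; 0, M.det] := by
    rw [← Matrix.mul_assoc, Matrix.mul_smul, Matrix.mul_adjugate, smul_smul, ← sq, hM, one_smul,
      Matrix.one_mul]
  obtain ⟨w, hw⟩ := exists_wordProd_eq_mod (i * j) ⟨Y, hdetY⟩
  refine ⟨w, ColumnDvd.congr (M := M * Y) ?_ ?_⟩
  · rw [hMY]
    simp [ColumnDvd, Matrix.mul_apply, Fin.sum_univ_two, hW0, hW1]
  · rw [map_intCast_mul _ M Y, map_intCast_mul _ M, hw]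

/-- One word serves all matrices `M` at once: the residues of `M` modulo `i * j` are treated one
after another, appending for each a word that suits the product reached so far. -/
theorem exists_universal_word {i j : ℕ} (hi : 0 < i) (hj : 0 < j) (hij : Nat.Coprime i j) :
    ∃ w : List Bool, ∀ M : Matrix (Fin 2) (Fin 2) ℤ, M.det ^ 2 = 1 →
      ∃ l ≤ w.length, ColumnDvd i j (M * wordProd (w.take l)) := by
  have : NeZero (i * j) := ⟨(Nat.mul_pos hi hj).ne'⟩
  classical
  have main : ∀ F : Finset (Matrix (Fin 2) (Fin 2) (ZMod (i * j))), ∃ w : List Bool,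
      ∀ M : Matrix (Fin 2) (Fin 2) ℤ, M.det ^ 2 = 1 → M.map Int.cast ∈ F →
        ∃ l ≤ w.length, ColumnDvd i j (M * wordProd (w.take l)) := by
    intro F
    induction F using Finset.induction_on with
    | empty => exact ⟨[], by simp⟩
    | insert g F _ ih =>
      obtain ⟨w, hw⟩ := ih
      by_cases hg : ∃ M : Matrix (Fin 2) (Fin 2) ℤ, M.det ^ 2 = 1 ∧ M.map Int.cast = g
      · obtain ⟨M₀, hd, rfl⟩ := hg
        obtain ⟨v, hv⟩ := exists_word_columnDvd hi hj hij (M₀ * wordProd w)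
          (by rw [Matrix.det_mul, mul_pow, hd, wordProd_det_sq, one_mul])
        refine ⟨w ++ v, fun M hM hMF => ?_⟩
        rcases Finset.mem_insert.mp hMF with h | h
        · refine ⟨(w ++ v).length, le_rfl, hv.congr ?_⟩
          rw [List.take_length, wordProd_append, ← Matrix.mul_assoc]
          simp only [map_intCast_mul, h]
        · obtain ⟨l, hl, hc⟩ := hw M hM h
          exact ⟨l, by simp; omega, by rwa [List.take_append_of_le_length hl]⟩
      · refine ⟨w, fun M hM hMF => ?_⟩
        rcases Finset.mem_insert.mp hMF with h | h
        · exact absurd ⟨M, hM, h⟩ hg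
        · exact hw M hM h
  obtain ⟨w, hw⟩ := main Finset.univ
  exact ⟨w, fun M hM => hw M hM (Finset.mem_univ _)⟩

end

/-! ### A schedule of density zero containing every word -/

/-- A partial sequence `F` in two letters that contains every word infinitely often in consecutive
positions, although the positions at which it is defined have density zero. -/
theorem exists_sparse_schedule : ∃ F : ℕ → Option Bool,
    (∀ (w : List Bool) (n₀ : ℕ), ∃ n ≥ n₀, ∀ (k : ℕ) (hk : k < w.length), F (n + k) = some w[k]) ∧
    ∀ ε : ℝ, 0 < ε → ∃ C : ℝ, ∀ n, (Nat.count (fun k => F k ≠ none) n : ℝ) ≤ ε * n + C := by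
  let word : ℕ → List Bool := fun k => (Encodable.decode (α := List Bool) k.unpair.1).getD []
  -- A word is written from position `2 ^ l` on, truncated to length `l`, so at most
  -- `(log₂ n + 1) ^ 2` positions below `n` are used.
  let F : ℕ → Option Bool := fun n =>
    if n - 2 ^ Nat.log 2 n < Nat.log 2 n then (word (Nat.log 2 n))[n - 2 ^ Nat.log 2 n]? else none
  refine ⟨F, fun w n₀ => ?_, fun ε hε => ?_⟩
  -- The second component of the pair is free, so each word is scheduled at arbitrarily large `e`.
  · let e := Nat.pair (Encodable.encode w) (n₀ + w.length)
    have hword : word e = w := by simp [word, e]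
    have he : n₀ + w.length ≤ e := Nat.right_le_pair _ _
    have hlt : e < 2 ^ e := Nat.lt_two_pow_self
    refine ⟨2 ^ e, by omega, fun k hk => ?_⟩
    have hlog : Nat.log 2 (2 ^ e + k) = e :=
      Nat.log_eq_of_pow_le_of_lt_pow (by omega) (by rw [pow_succ]; omega)
    simp only [F, hlog, hword, Nat.add_sub_cancel_left]
    rw [if_pos (by omega), List.getElem?_eq_getElem hk]
  · have hcount : ∀ n, Nat.count (fun k => F k ≠ none) n ≤ (Nat.log 2 n + 1) ^ 2 := by
      intro n
      rw [Nat.count_eq_card_filter_range]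
      have hsub : {k ∈ Finset.range n | F k ≠ none} ⊆
          (Finset.range (Nat.log 2 n + 1) ×ˢ Finset.range (Nat.log 2 n + 1)).image
            (fun p : ℕ × ℕ => 2 ^ p.1 + p.2) := by
        intro k hk
        rw [Finset.mem_filter, Finset.mem_range] at hk
        have h1 : k - 2 ^ Nat.log 2 k < Nat.log 2 k := by
          by_contra h
          exact hk.2 (if_neg h)
        have h0 : k ≠ 0 := by rintro rfl; simp at h1
        have h2 : Nat.log 2 k ≤ Nat.log 2 n := Nat.log_mono_right hk.1.le
        refine Finset.mem_image.mpr ⟨(Nat.log 2 k, k - 2 ^ Nat.log 2 k), ?_, ?_⟩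
        · simp only [Finset.mem_product, Finset.mem_range]; omega
        · exact Nat.add_sub_cancel' (Nat.pow_log_le_self 2 h0)
      refine (Finset.card_le_card hsub).trans (Finset.card_image_le.trans ?_)
      simp [sq]
    have hlim : Tendsto (fun l : ℕ => (l : ℝ) ^ 2 / 2 ^ l) atTop (nhds 0) :=
      tendsto_pow_const_div_const_pow_of_one_lt 2 one_lt_two
    obtain ⟨L, hL⟩ := eventually_atTop.mp (hlim.eventually (gt_mem_nhds (half_pos hε)))
    refine ⟨((L : ℝ) + 1) ^ 2, fun n => ?_⟩
    have h1 : (Nat.count (fun k => F k ≠ none) n : ℝ) ≤ ((Nat.log 2 n : ℝ) + 1) ^ 2 := by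
      exact_mod_cast hcount n
    refine h1.trans ?_
    rcases lt_or_ge (Nat.log 2 n) L with hlt | hge
    · have : (Nat.log 2 n : ℝ) ≤ L := mod_cast hlt.le
      have : ((Nat.log 2 n : ℝ) + 1) ^ 2 ≤ ((L : ℝ) + 1) ^ 2 := by gcongr
      have : 0 ≤ ε * n := by positivity
      linarith
    · rcases Nat.eq_zero_or_pos n with rfl | hn
      · rw [Nat.log_zero_right, Nat.cast_zero]
        nlinarith [(Nat.cast_nonneg L : (0 : ℝ) ≤ L)]
      have h2 := hL (Nat.log 2 n + 1) (by omega)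
      rw [div_lt_iff₀ (by positivity), pow_succ (2 : ℝ)] at h2
      have h3 : (2 : ℝ) ^ Nat.log 2 n ≤ n := mod_cast Nat.pow_log_le_self 2 hn.ne'
      push_cast at h2
      nlinarith [sq_nonneg ((L : ℝ) + 1)]

/-! ### Contraction, separation and number of the free digits -/

theorem IsDigit.mono {H H' : ℤ} {X : Matrix (Fin 2) (Fin 2) ℤ} (hX : IsDigit H X) (h : H ≤ H') :
    IsDigit H' X :=
  { hX with le_00 := hX.le_00.trans h, le_01 := hX.le_01.trans h }

/-- The Möbius action of a digit contracts distances in `[1, 3]` at most by the factor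
`(4 * H) ^ 2`. -/
theorem IsDigit.abs_sub_le {H : ℤ} {X : Matrix (Fin 2) (Fin 2) ℤ} (hX : IsDigit H X)
    {s s' t t' : ℝ} (ht : t ∈ Icc (1 : ℝ) 3) (ht' : t' ∈ Icc (1 : ℝ) 3)
    (hs : s * (X 1 0 * t + X 1 1) = X 0 0 * t + X 0 1)
    (hs' : s' * (X 1 0 * t' + X 1 1) = X 0 0 * t' + X 0 1) :
    |t - t'| ≤ (4 * (H : ℝ)) ^ 2 * |s - s'| := by
  have hd := hX.det_sq
  rw [Matrix.det_fin_two] at hd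
  have a1 : (1 : ℝ) ≤ X 1 0 := mod_cast hX.one_le_10
  have a2 : (0 : ℝ) ≤ X 1 1 := mod_cast hX.nonneg_11
  have a3 : (X 1 0 : ℝ) ≤ H := mod_cast hX.col0_le.trans hX.le_00
  have a4 : (X 1 1 : ℝ) ≤ H := mod_cast hX.col1_le.trans hX.le_01
  have b : ∀ t ∈ Icc (1 : ℝ) 3, 0 ≤ (X 1 0 : ℝ) * t + X 1 1 ∧ (X 1 0 : ℝ) * t + X 1 1 ≤ 4 * H := by
    rintro t ⟨h1, h3⟩
    constructor <;> nlinarith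
  have hdR : ((X 0 0 : ℝ) * X 1 1 - X 0 1 * X 1 0) ^ 2 = 1 := mod_cast hd
  have habs : |(X 0 0 : ℝ) * X 1 1 - X 0 1 * X 1 0| = 1 := by
    rcases sq_eq_one_iff.mp hdR with e | e <;> rw [e] <;> norm_num
  have hkey : ((X 0 0 : ℝ) * X 1 1 - X 0 1 * X 1 0) * (t - t') =
      (X 1 0 * t + X 1 1) * (X 1 0 * t' + X 1 1) * (s - s') := by
    linear_combination (X 1 0 * t + X 1 1 : ℝ) * hs' - (X 1 0 * t' + X 1 1 : ℝ) * hs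
  have h := congrArg abs hkey
  rw [abs_mul, habs, one_mul, abs_mul, abs_of_nonneg (mul_nonneg (b t ht).1 (b t' ht').1)] at h
  rw [h, sq]
  exact mul_le_mul_of_nonneg_right (mul_le_mul (b t ht).2 (b t' ht').2 (b t' ht').1
    ((b t ht).1.trans (b t ht).2)) (abs_nonneg _)

/-- A digit whose action sends `0` to `(q + r) / q` and which, having a large lower left entry, maps
`[1, 3]` close to that fraction. The matrix is `!![p, p'; q, q'] * !![64, 1; 1, 0]` with
`p = q + r` and `p' / q'` a Farey neighbour of `p / q`. -/
theorem exists_isDigit {N q r : ℕ} (hqN : q ≤ N) (hq : 2 ≤ q) (hrq : r < q) (h : Nat.Coprime q r) :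
    ∃ X : Matrix (Fin 2) (Fin 2) ℤ, IsDigit (130 * N) X ∧ X 0 1 = q + r ∧ X 1 1 = q ∧
      64 * (q : ℤ) ≤ X 1 0 := by
  have hr0 : r ≠ 0 := by
    rintro rfl
    rw [Nat.coprime_zero_right] at h
    omega
  obtain ⟨m, hmq, hm⟩ := Nat.exists_mul_mod_eq_one_of_coprime h.symm (by omega)
  obtain ⟨v, hv, hdiv⟩ : ∃ v ≤ r, q * v + 1 = r * m := by
    refine ⟨r * m / q, Nat.div_le_of_le_mul ?_, ?_⟩
    · rw [mul_comm q r]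
      exact Nat.mul_le_mul_left r hmq.le
    · rw [← hm, Nat.div_add_mod]
  have hd : (q : ℤ) * v + 1 = r * m := mod_cast hdiv
  refine ⟨!![64 * (q + r) + (m + v), q + r; 64 * q + m, q], ?_, rfl, rfl, ?_⟩
  · constructor
    · rw [Matrix.det_fin_two_of]
      have : ((64 * (q + r) + (m + v)) * q - (q + r) * (64 * q + m) : ℤ) = -1 := by
        linear_combination hd
      rw [this]; norm_num
    all_goals simp <;> omega
  · simp

/-- Distinct fractions of denominator at most `4 * K` are `1 / (16 * K ^ 2)` apart, and the images
of the two digits lie within `1 / (64 * K ^ 2)` of their fractions. -/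
theorem digit_separation {K q r q' r' : ℕ} {X X' : Matrix (Fin 2) (Fin 2) ℤ}
    (hK : 0 < K) (hq : K < q) (hq' : K < q') (hqK : q ≤ 4 * K) (hqK' : q' ≤ 4 * K)
    (hc : Nat.Coprime q r) (hc' : Nat.Coprime q' r') (hne : ¬ (q = q' ∧ r = r'))
    {H : ℤ} (hX : IsDigit H X) (hX' : IsDigit H X')
    (h01 : X 0 1 = q + r) (h11 : X 1 1 = q) (h10 : 64 * (q : ℤ) ≤ X 1 0)
    (h01' : X' 0 1 = q' + r') (h11' : X' 1 1 = q') (h10' : 64 * (q' : ℤ) ≤ X' 1 0)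
    {s s' t t' : ℝ} (ht : 1 ≤ t) (ht' : 1 ≤ t')
    (hs : s * (X 1 0 * t + X 1 1) = X 0 0 * t + X 0 1)
    (hs' : s' * (X' 1 0 * t' + X' 1 1) = X' 0 0 * t' + X' 0 1) :
    1 / (32 * (K : ℝ) ^ 2) ≤ |s - s'| := by
  have near : ∀ {q r : ℕ} {X : Matrix (Fin 2) (Fin 2) ℤ} {s t : ℝ}, K < q → IsDigit H X →
      X 0 1 = q + r → X 1 1 = q → 64 * (q : ℤ) ≤ X 1 0 → 1 ≤ t →
      s * (X 1 0 * t + X 1 1) = X 0 0 * t + X 0 1 →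
      |s - (q + r : ℝ) / q| ≤ 1 / (64 * (K : ℝ) ^ 2) := by
    intro q r X s t hq hX h01 h11 h10 ht hs
    have hd := hX.det_sq
    rw [Matrix.det_fin_two, h01, h11] at hd
    rw [h01, h11] at hs
    push_cast at hs
    have hKR : (0 : ℝ) < K := mod_cast hK
    have hqR : (K : ℝ) < q := mod_cast hq
    have hq0 : (0 : ℝ) < q := hKR.trans hqR
    have hQ : 64 * (q : ℝ) ≤ X 1 0 := mod_cast h10
    have hdR : ((X 0 0 : ℝ) * q - (q + r) * X 1 0) ^ 2 = 1 := mod_cast hd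
    have habs : |(X 0 0 : ℝ) * q - (q + r) * X 1 0| = 1 := by
      rcases sq_eq_one_iff.mp hdR with e | e <;> rw [e] <;> norm_num
    have hpos : (0 : ℝ) < X 1 0 * t + q := by nlinarith
    have hkey : (s - (q + r : ℝ) / q) * (q * (X 1 0 * t + q)) =
        ((X 0 0 : ℝ) * q - (q + r) * X 1 0) * t := by
      field_simp
      linear_combination (q : ℝ) * hs
    have h2 := congrArg abs hkey
    rw [abs_mul, abs_mul _ t, habs, one_mul, abs_of_pos (mul_pos hq0 hpos),
      abs_of_pos (by linarith : 0 < t)] at h2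
    have h3 : 64 * (K : ℝ) ^ 2 * t ≤ q * (X 1 0 * t + q) := by
      have e1 : 64 * (K : ℝ) * t ≤ X 1 0 * t + q := by nlinarith
      nlinarith
    rw [le_div_iff₀ (by positivity)]
    have h4 := mul_le_mul_of_nonneg_left h3 (abs_nonneg (s - (q + r : ℝ) / q))
    rw [h2] at h4
    nlinarith
  have hKR : (0 : ℝ) < K := mod_cast hK
  have hq0 : (0 : ℝ) < q := hKR.trans (mod_cast hq)
  have hq0' : (0 : ℝ) < q' := hKR.trans (mod_cast hq')
  have hcross : (r : ℤ) * q' - r' * q ≠ 0 := by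
    intro h0
    have h1 : r * q' = r' * q := by
      have : (r : ℤ) * q' = r' * q := by linarith
      exact_mod_cast this
    have d1 : q ∣ q' := hc.dvd_of_dvd_mul_left (h1 ▸ Dvd.intro_left _ rfl)
    have d2 : q' ∣ q := hc'.dvd_of_dvd_mul_left (h1 ▸ Dvd.intro_left _ rfl)
    have e := Nat.dvd_antisymm d1 d2
    refine hne ⟨e, ?_⟩
    rw [← e] at h1
    exact Nat.eq_of_mul_eq_mul_right (by omega) h1
  have hfar : 1 / (16 * (K : ℝ) ^ 2) ≤ |(q + r : ℝ) / q - (q' + r' : ℝ) / q'| := by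
    have e : (q + r : ℝ) / q - (q' + r' : ℝ) / q' = ((r : ℤ) * q' - r' * q : ℤ) / (q * q') := by
      push_cast
      field_simp
      ring
    have h1 : (1 : ℝ) ≤ |(((r : ℤ) * q' - r' * q : ℤ) : ℝ)| := by
      rw [← Int.cast_abs, ← Int.cast_one]
      exact Int.cast_le.mpr (Int.one_le_abs hcross)
    rw [e, abs_div, abs_of_pos (mul_pos hq0 hq0')]
    refine div_le_div₀ (abs_nonneg _) h1 (mul_pos hq0 hq0') ?_
    have f1 : (q : ℝ) ≤ 4 * K := mod_cast hqK
    have f2 : (q' : ℝ) ≤ 4 * K := mod_cast hqK'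
    nlinarith
  have n1 := near hq hX h01 h11 h10 ht hs
  have n2 := near hq' hX' h01' h11' h10' ht' hs'
  have e1 : 1 / (16 * (K : ℝ) ^ 2) = 1 / (32 * (K : ℝ) ^ 2) + 1 / (64 * (K : ℝ) ^ 2) +
      1 / (64 * (K : ℝ) ^ 2) := by
    field_simp
    norm_num
  rw [abs_le] at n1 n2
  rw [e1] at hfar
  rcases le_abs.mp hfar with h | h
  · exact le_abs.mpr (Or.inl (by linarith))
  · exact le_abs.mpr (Or.inr (by linarith))

/-- Summing `n = ∑ d ∣ n, φ d` over `n ≤ 4 * K` gives `∑ φ d * (4 * K / d) = 8 * K ^ 2 + 2 * K`,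
where the `d ≤ K` contribute at most `4 * K ^ 2`; for `d > K` the second factor is at most `4`. -/
theorem sq_le_sum_totient (K : ℕ) : K ^ 2 ≤ ∑ q ∈ Finset.Ioc K (4 * K), Nat.totient q := by
  have hsum : ∑ n ∈ Finset.Ioc 0 (4 * K), n =
      ∑ d ∈ Finset.Ioc 0 (4 * K), Nat.totient d * (4 * K / d) := by
    have h1 : ∀ n ∈ Finset.Ioc 0 (4 * K), n =
        ∑ d ∈ Finset.Ioc 0 (4 * K), if d ∣ n then Nat.totient d else 0 := by
      intro n hn
      rw [Finset.mem_Ioc] at hn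
      conv_lhs => rw [← Nat.sum_totient n]
      rw [← Finset.sum_filter]
      refine Finset.sum_congr ?_ fun _ _ => rfl
      ext d
      simp only [Nat.mem_divisors, Finset.mem_filter, Finset.mem_Ioc]
      exact ⟨fun h => ⟨⟨Nat.pos_of_dvd_of_pos h.1 hn.1, (Nat.le_of_dvd hn.1 h.1).trans hn.2⟩, h.1⟩,
        fun h => ⟨h.2, by omega⟩⟩
    rw [Finset.sum_congr rfl h1, Finset.sum_comm]
    refine Finset.sum_congr rfl fun d _ => ?_
    rw [← Finset.sum_filter, Finset.sum_const, Nat.Ioc_filter_dvd_card_eq_div, smul_eq_mul,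
      mul_comm]
  have hgauss : ∑ n ∈ Finset.Ioc 0 (4 * K), n = 8 * K ^ 2 + 2 * K := by
    have h := Finset.sum_range_id_mul_two (4 * K + 1)
    rw [Finset.range_eq_Ico, Finset.sum_eq_sum_Ico_succ_bot (by omega)] at h
    have e : Finset.Ioc 0 (4 * K) = Finset.Ico (0 + 1) (4 * K + 1) := by
      ext; simp only [Finset.mem_Ioc, Finset.mem_Ico]; omega
    rw [e]
    simp only [Nat.add_sub_cancel] at h
    nlinarith
  rw [hgauss, ← Finset.sum_Ioc_consecutive _ (Nat.zero_le K) (by omega : K ≤ 4 * K)] at hsum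
  have hlow : ∑ d ∈ Finset.Ioc 0 K, Nat.totient d * (4 * K / d) ≤ K * (4 * K) := by
    have h : ∀ d ∈ Finset.Ioc 0 K, Nat.totient d * (4 * K / d) ≤ 4 * K := fun d _ =>
      (Nat.mul_le_mul_right _ (Nat.totient_le d)).trans (Nat.mul_div_le _ _)
    refine (Finset.sum_le_card_nsmul _ _ _ h).trans ?_
    simp
  have hhigh : ∑ d ∈ Finset.Ioc K (4 * K), Nat.totient d * (4 * K / d) ≤
      (∑ d ∈ Finset.Ioc K (4 * K), Nat.totient d) * 4 := by
    rw [Finset.sum_mul]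
    refine Finset.sum_le_sum fun d hd => Nat.mul_le_mul_left _ ?_
    rw [Finset.mem_Ioc] at hd
    exact Nat.div_le_of_le_mul (by nlinarith)
  nlinarith

/-! ### The Cantor set -/

/-- The digit sequence that follows the word letters prescribed by `F` where these are defined, and
elsewhere runs through the free digits `Λ (f 0), Λ (f 1), …` in order. -/
def scheduledDigits {D : ℕ} (F : ℕ → Option Bool) (Λ : Fin D → Matrix (Fin 2) (Fin 2) ℤ)
    (f : ℕ → Fin D) (n : ℕ) : Matrix (Fin 2) (Fin 2) ℤ :=
  (F n).elim (Λ (f (Nat.count (fun k => F k = none) n))) wordDigit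

theorem isDigit_scheduledDigits {D : ℕ} {H : ℤ} (hH : 2 ≤ H) (F : ℕ → Option Bool)
    {Λ : Fin D → Matrix (Fin 2) (Fin 2) ℤ} (hΛ : ∀ a, IsDigit H (Λ a)) (f : ℕ → Fin D) (n : ℕ) :
    IsDigit H (scheduledDigits F Λ f n) := by
  unfold scheduledDigits
  cases F n with
  | none => exact hΛ _
  | some b => exact (isDigit_wordDigit b).mono hH

theorem prefixProd_add_eq {A : ℕ → Matrix (Fin 2) (Fin 2) ℤ} {w : List Bool} {n : ℕ}
    (h : ∀ (k : ℕ) (hk : k < w.length), A (n + k) = wordDigit w[k]) {l : ℕ} (hl : l ≤ w.length) :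
    prefixProd A (n + l) = prefixProd A n * wordProd (w.take l) := by
  induction l with
  | zero => simp [wordProd]
  | succ l ih =>
    rw [← add_assoc, prefixProd, ih (by omega), h l (by omega), List.take_succ_eq_append_getElem
      (by omega), wordProd_append, Matrix.mul_assoc]
    simp [wordProd]

theorem mem_fastDecaying {H : ℤ} {A : ℕ → Matrix (Fin 2) (Fin 2) ℤ} {t : ℕ → ℝ}
    (hA : ∀ n, IsDigit H (A n)) (ht : IsExpansion A t)
    (hw : ∀ (w : List Bool) (n₀ : ℕ), ∃ n ≥ n₀, ∀ (k : ℕ) (hk : k < w.length),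
      A (n + k) = wordDigit w[k]) :
    t 0 ∈ fastDecaying := by
  have key : ∀ i j : ℕ, 0 < i → 0 < j → Nat.Coprime i j → ∃ᶠ q : ℕ in atTop, ∃ u : ℤ,
      (q : ℝ) * |(q : ℝ) * ((i : ℝ) / (j : ℝ) * t 0) - u| ≤ 1 / ((i : ℝ) * (j : ℝ)) := by
    intro i j hi hj hij
    refine ht.frequently_le hA hi hj fun n₀ => ?_
    obtain ⟨w, hw'⟩ := exists_universal_word hi hj hij
    obtain ⟨n, hn, hk⟩ := hw w n₀
    obtain ⟨l, hl, hc⟩ := hw' _ (prefixProd_det_sq hA n)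
    rw [← prefixProd_add_eq hk hl] at hc
    exact ⟨n + l, by omega, hc⟩
  refine ⟨?_, fun i j hi hj hij => lagrangeConst_le_of_frequently (key i j hi hj hij)⟩
  have hH : (1 : ℝ) ≤ H := by exact_mod_cast (hA 0).one_le_00.trans (hA 0).le_00
  have h1 := key 1 1 one_pos one_pos (Nat.coprime_one_right 1)
  simp only [Nat.cast_one, div_one, one_mul] at h1
  exact lt_of_lt_of_le (by positivity) (le_lagrangeConst h1 (ht.le_mul_abs hA))

theorem count_none_add_count_ne_none (F : ℕ → Option Bool) (n : ℕ) :
    Nat.count (fun k => F k = none) n + Nat.count (fun k => F k ≠ none) n = n := by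
  induction n with
  | zero => simp
  | succ n ih =>
    rw [Nat.count_succ, Nat.count_succ]
    by_cases h : F n = none <;> simp [h] at ih ⊢ <;> omega

/-- The `k`-th free position, counted from zero. -/
theorem exists_free_position {F : ℕ → Option Bool}
    (hF : ∀ ε : ℝ, 0 < ε → ∃ C : ℝ, ∀ n, (Nat.count (fun k => F k ≠ none) n : ℝ) ≤ ε * n + C)
    (k : ℕ) : ∃ n, F n = none ∧ Nat.count (fun k => F k = none) n = k := by
  have hex : ∃ n, k < Nat.count (fun k => F k = none) n := by
    obtain ⟨C, hC⟩ := hF (1 / 2) (by norm_num)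
    obtain ⟨n, hn⟩ := exists_nat_gt (2 * (k + C))
    refine ⟨n, ?_⟩
    have h1 := hC n
    have h2 : (Nat.count (fun k => F k = none) n : ℝ) + Nat.count (fun k => F k ≠ none) n = n :=
      mod_cast count_none_add_count_ne_none F n
    have : (k : ℝ) < Nat.count (fun k => F k = none) n := by linarith
    exact_mod_cast this
  obtain ⟨n, hn⟩ : ∃ n, Nat.find hex = n + 1 :=
    Nat.exists_eq_succ_of_ne_zero fun h => by have := Nat.find_spec hex; simp [h] at this
  have h1 := Nat.find_spec hex
  have h2 := Nat.find_min hex (m := n) (by omega)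
  rw [hn, Nat.count_succ] at h1
  by_cases h : F n = none
  · exact ⟨n, h, by simp [h] at h1; omega⟩
  · simp [h] at h1; omega

/-- Numbers whose first `n` digits agree are not much closer than their `n`-th tails. -/
theorem IsExpansion.abs_sub_le {H : ℤ} {A A' : ℕ → Matrix (Fin 2) (Fin 2) ℤ} {t t' : ℕ → ℝ}
    (hA : ∀ n, IsDigit H (A n)) (ht : IsExpansion A t) (ht' : IsExpansion A' t') {n : ℕ}
    (h : ∀ k < n, A k = A' k) :
    |t n - t' n| ≤ ((4 * (H : ℝ)) ^ 2) ^ n * |t 0 - t' 0| := by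
  induction n with
  | zero => simp
  | succ n ih =>
    have hs' := ht'.step n
    rw [← h n (Nat.lt_succ_self n)] at hs'
    have h1 := (hA n).abs_sub_le ⟨ht.one_le _, ht.le_three _⟩ ⟨ht'.one_le _, ht'.le_three _⟩
      (ht.step n) hs'
    calc _ ≤ (4 * (H : ℝ)) ^ 2 * |t n - t' n| := h1
      _ ≤ (4 * (H : ℝ)) ^ 2 * (((4 * (H : ℝ)) ^ 2) ^ n * |t 0 - t' 0|) := by
        gcongr
        exact ih fun k hk => h k (by omega)
      _ = _ := by ring

/-- An alphabet of `D` separated free digits bounded by `H` yields a subset of `fastDecaying` of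
dimension at least `s`, as soon as `s < log D / log ((4 * H) ^ 2)`; the margin `ε` absorbs the
scheduled words. -/
theorem le_dimH_fastDecaying_of_alphabet {D : ℕ} (hD : 1 < D) {H : ℤ} (hH : 2 ≤ H)
    {Λ : Fin D → Matrix (Fin 2) (Fin 2) ℤ} (hΛ : ∀ a, IsDigit H (Λ a)) {δ : ℝ} (hδ : 0 < δ)
    (hsep : ∀ a b, a ≠ b → ∀ s s' t t' : ℝ, 1 ≤ t → 1 ≤ t' →
      s * (Λ a 1 0 * t + Λ a 1 1) = Λ a 0 0 * t + Λ a 0 1 →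
      s' * (Λ b 1 0 * t' + Λ b 1 1) = Λ b 0 0 * t' + Λ b 0 1 → δ ≤ |s - s'|)
    {s : NNReal} (hs : 0 < s) {ε : ℝ} (hε : 0 < ε)
    (hR : ((4 * (H : ℝ)) ^ 2) ^ (s : ℝ) ≤ (D : ℝ) ^ (1 - ε)) :
    (s : ENNReal) ≤ dimH fastDecaying := by
  obtain ⟨F, hFw, hFc⟩ := exists_sparse_schedule
  choose t ht using fun f : ℕ → Fin D =>
    exists_isExpansion (isDigit_scheduledDigits hH F hΛ f)
  have hsub : range (fun f => t f 0) ⊆ fastDecaying := by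
    rintro _ ⟨f, rfl⟩
    refine mem_fastDecaying (isDigit_scheduledDigits hH F hΛ f) (ht f) fun w n₀ => ?_
    obtain ⟨n, hn, hk⟩ := hFw w n₀
    exact ⟨n, hn, fun k hkw => by rw [scheduledDigits, hk k hkw]; rfl⟩
  refine le_trans ?_ (dimH_mono hsub)
  obtain ⟨C, hC⟩ := hFc ε hε
  have hD0 : (0 : ℝ) < D := by positivity
  have hD1 : (1 : ℝ) ≤ D := mod_cast hD.le
  have hC' : (0 : ℝ) ≤ (D : ℝ) ^ C * δ⁻¹ ^ (s : ℝ) := by positivity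
  refine le_dimH_range_of_digit_separation hD _ (C := ⟨_, hC'⟩) hs fun f g k hlt hne => ?_
  obtain ⟨n, hn, hcount⟩ := exists_free_position hFc k
  have hagree : ∀ m < n, scheduledDigits F Λ f m = scheduledDigits F Λ g m := by
    intro m hm
    unfold scheduledDigits
    cases h : F m with
    | some b => rfl
    | none =>
      have : Nat.count (fun k => F k = none) m < k := hcount ▸ Nat.count_strict_mono h hm
      simp only [Option.elim_none, hlt _ this]
  have hdigit : ∀ f : ℕ → Fin D, scheduledDigits F Λ f n = Λ (f k) := by
    intro f
    simp only [scheduledDigits, hn, Option.elim_none, hcount]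
  have hf := (ht f).step n
  have hg := (ht g).step n
  rw [hdigit] at hf hg
  have h1 := hsep _ _ hne _ _ _ _ ((ht f).one_le _) ((ht g).one_le _) hf hg
  have h2 := h1.trans ((ht f).abs_sub_le (isDigit_scheduledDigits hH F hΛ f) (ht g) hagree)
  set R : ℝ := (4 * (H : ℝ)) ^ 2 with hRdef
  set x : ℝ := |t f 0 - t g 0|
  have hx : 0 ≤ x := abs_nonneg _
  have hHR : (2 : ℝ) ≤ H := mod_cast hH
  have hRpos : 0 < R := by positivity
  have h3 : δ ^ (s : ℝ) ≤ (D : ℝ) ^ (k + C) * x ^ (s : ℝ) := by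
    calc δ ^ (s : ℝ) ≤ (R ^ n * x) ^ (s : ℝ) := Real.rpow_le_rpow hδ.le h2 s.coe_nonneg
      _ = (R ^ (s : ℝ)) ^ n * x ^ (s : ℝ) := by
        rw [Real.mul_rpow (by positivity) hx, ← Real.rpow_natCast, ← Real.rpow_natCast,
          ← Real.rpow_mul hRpos.le, ← Real.rpow_mul hRpos.le, mul_comm (n : ℝ)]
      _ ≤ ((D : ℝ) ^ (1 - ε)) ^ n * x ^ (s : ℝ) := by gcongr
      _ ≤ (D : ℝ) ^ (k + C) * x ^ (s : ℝ) := by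
        refine mul_le_mul_of_nonneg_right ?_ (by positivity)
        rw [← Real.rpow_natCast, ← Real.rpow_mul hD0.le]
        refine Real.rpow_le_rpow_of_exponent_le hD1 ?_
        have e1 : (k : ℝ) + Nat.count (fun k => F k ≠ none) n = n := by
          rw [← hcount]
          exact_mod_cast count_none_add_count_ne_none F n
        linarith [hC n]
  rw [Real.rpow_add hD0, Real.rpow_natCast] at h3
  change ((D : ℝ) ^ k)⁻¹ ≤ ((D : ℝ) ^ C * δ⁻¹ ^ (s : ℝ)) * x ^ (s : ℝ)
  rw [Real.inv_rpow hδ.le, inv_le_iff_one_le_mul₀ (by positivity)]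
  have hδs : 0 < δ ^ (s : ℝ) := by positivity
  calc (1 : ℝ) = δ ^ (s : ℝ) / δ ^ (s : ℝ) := (div_self hδs.ne').symm
    _ ≤ (D : ℝ) ^ k * (D : ℝ) ^ C * x ^ (s : ℝ) / δ ^ (s : ℝ) := by gcongr
    _ = _ := by field_simp

theorem le_dimH_fastDecaying {s : NNReal} (hs : 0 < s) (hs1 : s < 1) :
    (s : ENNReal) ≤ dimH fastDecaying := by
  have hs1R : (s : ℝ) < 1 := mod_cast hs1
  obtain ⟨K, hK2, hK⟩ : ∃ K : ℕ, 2 ≤ K ∧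
      ((4 * ((130 * (4 * K : ℕ) : ℤ) : ℝ)) ^ 2) ^ (s : ℝ) ≤
        ((K : ℝ) ^ 2) ^ (1 - (1 - (s : ℝ)) / 2) := by
    have hlim : Tendsto (fun K : ℕ => (K : ℝ) ^ (1 - (s : ℝ))) atTop atTop :=
      (tendsto_rpow_atTop (by linarith)).comp tendsto_natCast_atTop_atTop
    obtain ⟨K, hK, hK2⟩ := ((hlim.eventually_ge_atTop (((2080 : ℝ) ^ 2) ^ (s : ℝ))).and
      (eventually_ge_atTop 2)).exists
    refine ⟨K, hK2, ?_⟩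
    have hK0 : (0 : ℝ) < K := by positivity
    -- Digits attached to denominators up to `4 * K` are bounded by `H = 130 * (4 * K)`, and the
    -- contraction is controlled by `(4 * H) ^ 2`.
    have e1 : (4 * ((130 * (4 * K : ℕ) : ℤ) : ℝ)) ^ 2 = (2080 : ℝ) ^ 2 * (K : ℝ) ^ 2 := by
      push_cast; ring
    have e2 : ((K : ℝ) ^ 2) ^ (1 - (1 - (s : ℝ)) / 2) =
        (K : ℝ) ^ (1 - (s : ℝ)) * ((K : ℝ) ^ 2) ^ (s : ℝ) := by
      rw [← Real.rpow_natCast, ← Real.rpow_mul hK0.le, ← Real.rpow_mul hK0.le,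
        ← Real.rpow_add hK0]
      congr 1
      push_cast; ring
    rw [e1, e2, Real.mul_rpow (by positivity) (by positivity)]
    gcongr
  let I : Finset (Σ _ : ℕ, ℕ) :=
    (Finset.Ioc K (4 * K)).sigma fun q => {r ∈ Finset.range q | q.Coprime r}
  have hcard : K ^ 2 ≤ I.card := by
    rw [Finset.card_sigma]
    exact sq_le_sum_totient K
  have hI : ∀ p ∈ I, (K < p.1 ∧ p.1 ≤ 4 * K) ∧ p.2 < p.1 ∧ p.1.Coprime p.2 := by
    intro p hp
    simpa only [I, Finset.mem_sigma, Finset.mem_Ioc, Finset.mem_filter, Finset.mem_range] using hp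
  have hex : ∀ a : Fin I.card, ∃ X : Matrix (Fin 2) (Fin 2) ℤ, IsDigit (130 * (4 * K : ℕ)) X ∧
      X 0 1 = (I.equivFin.symm a).1.1 + (I.equivFin.symm a).1.2 ∧
      X 1 1 = (I.equivFin.symm a).1.1 ∧ 64 * ((I.equivFin.symm a).1.1 : ℤ) ≤ X 1 0 := by
    intro a
    have h := hI _ (I.equivFin.symm a).2
    exact exists_isDigit h.1.2 (by omega) h.2.1 h.2.2
  choose Λ hΛ h01 h11 h10 using hex
  have hδ : 0 < 1 / (32 * (K : ℝ) ^ 2) := by positivity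
  refine le_dimH_fastDecaying_of_alphabet (D := I.card) (by nlinarith) (by push_cast; omega) hΛ hδ
    ?_ hs (ε := (1 - (s : ℝ)) / 2) (by linarith) (hK.trans ?_)
  · intro a b hab s s' t t' ht ht' e e'
    have ha := hI _ (I.equivFin.symm a).2
    have hb := hI _ (I.equivFin.symm b).2
    refine digit_separation (by omega) ha.1.1 hb.1.1 ha.1.2 hb.1.2 ha.2.2 hb.2.2 ?_ (hΛ a) (hΛ b)
      (h01 a) (h11 a) (h10 a) (h01 b) (h11 b) (h10 b) ht ht' e e'
    rintro ⟨e1, e2⟩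
    exact hab (I.equivFin.symm.injective (Subtype.ext (Sigma.ext e1 (heq_of_eq e2))))
  · refine Real.rpow_le_rpow (by positivity) (by exact_mod_cast hcard) ?_
    linarith [s.coe_nonneg]

theorem dimH_fastDecaying : dimH fastDecaying = 1 := by
  refine le_antisymm ((dimH_mono (subset_univ _)).trans_eq Real.dimH_univ) ?_
  refine le_of_forall_lt fun c hc => ?_
  obtain ⟨s, hcs, hs1⟩ := ENNReal.lt_iff_exists_nnreal_btwn.mp hc
  refine hcs.trans_le (le_dimH_fastDecaying ?_ (by exact_mod_cast hs1))
  have : (0 : ENNReal) < s := zero_le.trans_lt hcs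
  exact_mod_cast this

theorem fastDecaying_subset : fastDecaying ⊆ decayingBadlyApproximable := by
  rintro x ⟨hx, h⟩
  refine ⟨hx, 1, one_pos, fun i hi => ?_⟩
  simpa using h i 1 hi one_pos (Nat.coprime_one_right i)

theorem theorem1p3 :
    dimH fastDecaying = 1 ∧
      fastDecaying ⊆ decayingBadlyApproximable ∧
      dimH decayingBadlyApproximable = 1 :=
  ⟨dimH_fastDecaying, fastDecaying_subset,
    le_antisymm ((dimH_mono (subset_univ _)).trans_eq Real.dimH_univ)
      (dimH_fastDecaying.symm.trans_le (dimH_mono fastDecaying_subset))⟩
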